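/- **Theorem.** The $C_0, C_1, C_2$ ordinal notation system (built-from-below with passthrough, basic version) is well-founded, even if built above an arbitrary ordinal. Explicitly: *Terms.* Fix a well-ordered set $K$ of constants with a distinguished element $k_0 \in K$ (the base). Terms are the constants and the formal expressions $C_i(a,b)$ with $i \in \{0,1,2\}$ and $a, b$ terms. Subterms are always understood together with their position. *Comparison.* Constants are compared as in $K$, and every constant is smaller than every $C_i(a,b)$. Further, $C_i(a,b) < C_j(c,d)$ if $C_i(a,b) \le d$; $C_i(a,b) \not< C_j(c,d)$ if $b \ge C_j(c,d)$; otherwise $C_i(a,b) < C_j(c,d)$ iff $(i,a) < (j,c)$ lexicographically. *Standard terms.* All constants are standard. $C_i(a,b)$ is standard iff 1. $a$ and $b$ are standard; 2. $b = k_0$, or $b = C_j(c,d)$ with $(i,a) \le (j,c)$ lexicographically; 3. $a$ is built from below from $< C_i(a,b)$ with passthrough for $(C_j : j < i)$, that is, every subterm $y$ of $a$ with $y > a$ either is a subterm (not necessarily proper) of a subterm $z$ of $a$ with $z < C_i(a,b)$, or is a proper subterm of a subterm $z = C_j(e,f)$ of $a$ with $j < i$ such that every $w$ lying between $y$ and $z$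 (inclusive) in the subterm tree satisfies $w \ge z$. *Conclusion.* Let $\alpha$ be any ordinal. In each of the following two cases, the set of standard terms is well-ordered by $<$ (that is, $<$ is linear and well-founded on it): - $K = \{0\} \cup \{\beta : \beta < \alpha\}$ and $k_0 = 0$ (the ordinals below $\alpha$ are constants, and all $C_i(a,b)$ lie above them; for $\alpha = 0$ this is the system with the single constant $0$); - $K = \{\beta : \beta \le \alpha\}$ and $k_0 = \alpha$ (the ordinals up to $\alpha$ are constants, and $C_i(a,b)$ is used only for $b \ge \alpha$). No assumption beyond the usual axioms of set theory (ZFC) is made. -/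

import Mathlib

universe u

namespace Passthrough

/-- Raw terms of the `C_0, C_1, C_2` system over a type `K` of constants; `C i a b` stands for
`C_i(a, b)`. -/
inductive Term (K : Type u) : Type u
  | const (k : K) : Term K
  | C (i : Fin 3) (a b : Term K) : Term K

namespace Term

variable {K : Type u}

/-- Standard comparison. All constants lie below all terms `C_i(a, b)`, and
`C_i(a, b) < C_j(c, d)` holds if `C_i(a, b) ≤ d`; it fails if `b ≥ C_j(c, d)`; otherwise it holds
iff `(i, a) < (j, c)` lexicographically. -/
def lt [LT K] : Term K → Term K → Prop
  | const x, const y => x < y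
  | const _, C _ _ _ => True
  | C _ _ _, const _ => False
  | C i a b, C j c d =>
      (C i a b = d ∨ lt (C i a b) d) ∨
        (¬ (C j c d = b ∨ lt (C j c d) b) ∧ (i < j ∨ (i = j ∧ lt a c)))
termination_by s t => sizeOf s + sizeOf t

/-- `s ≤ t` in the standard comparison. -/
def le [LT K] (s t : Term K) : Prop := s = t ∨ lt s t

/-- `(i, a) ≤ (j, c)` lexicographically. -/
def degLE [LT K] (i : Fin 3) (a : Term K) (j : Fin 3) (c : Term K) : Prop :=
  i < j ∨ (i = j ∧ le a c)

/-- `IsOcc a p`: the nonempty list `p` describes an occurrence of a subterm in `a`. Its head is the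
subterm itself, followed by the subterms of `a` in whose scope the occurrence properly lies, from
the innermost one to `a` (which is the last entry of `p`). -/
inductive IsOcc (a : Term K) : List (Term K) → Prop
  | root : IsOcc a [a]
  | left {j : Fin 3} {e f : Term K} {p : List (Term K)} :
      IsOcc a (C j e f :: p) → IsOcc a (e :: C j e f :: p)
  | right {j : Fin 3} {e f : Term K} {p : List (Term K)} :
      IsOcc a (C j e f :: p) → IsOcc a (f :: C j e f :: p)

/-- The term `z` has the form `C_j(e, f)` with `j < i`. -/
def LevelBelow (i : Fin 3) (z : Term K) : Prop :=
  ∃ (j : Fin 3) (e f : Term K), z = C j e f ∧ j < i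

/-- `a` is built from below from `< t` with passthrough for `C_j`, `j < i`: every occurrence in `a`
of a subterm `y > a` is
* in the scope of a subterm `z < t` (possibly `y` itself), or
* a proper subterm of some `z = C_j(e, f)`, `j < i`, and not in the scope of a subterm of `z`
  that is `< z`. -/
def BuiltFromBelow [LT K] (i : Fin 3) (a t : Term K) : Prop :=
  ∀ (y : Term K) (p : List (Term K)), IsOcc a (y :: p) → lt a y →
    (∃ z ∈ y :: p, lt z t) ∨
    (∃ (q : List (Term K)) (z : Term K) (r : List (Term K)),
      p = q ++ z :: r ∧ LevelBelow i z ∧ ∀ w ∈ y :: q, le z w)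

/-- Standard terms; `base` is the only constant permitted as the second argument of a `C_i`. -/
inductive Standard [LT K] (base : K) : Term K → Prop
  | const (k : K) : Standard base (const k)
  | C {i : Fin 3} {a b : Term K} :
      Standard base a → Standard base b →
      (b = .const base ∨ ∃ (j : Fin 3) (c d : Term K), b = .C j c d ∧ degLE i a j c) →
      BuiltFromBelow i a (.C i a b) →
      Standard base (.C i a b)

end Term

/-- The system: the standard terms. -/
def Notation (K : Type u) [LT K] (base : K) : Type u := {t : Term K // Term.Standard base t}

/-- The order of the system: standard comparison on the standard terms. -/
def Notation.lt {K : Type u} [LT K] {base : K} (s t : Notation K base) : Prop :=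
  Term.lt s.1 t.1

/-- First way of building the system above `α`: the constants are `0` and the ordinals `< α`, and
every `C_i(a, b)` lies above them. -/
abbrev AboveConstants (α : Ordinal.{u}) : Type (u + 1) :=
  Notation {β : Ordinal.{u} // β = 0 ∨ β < α} ⟨0, Or.inl rfl⟩

/-- Second way of building the system above `α`: the constants are the ordinals `≤ α`, and
`C_i(a, b)` is used only for `b ≥ α`. -/
abbrev AboveOrdinal (α : Ordinal.{u}) : Type (u + 1) :=
  Notation {β : Ordinal.{u} // β ≤ α} ⟨α, le_rfl⟩

end Passthrough

universe v

namespace Passthrough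

namespace Term

/-! ### Linearity of the comparison on standard terms. -/

section Order

variable {K : Type u} [LinearOrder K]

/-! Well-foundedness is proved with all ordinals as constants, then pulled back. A minimal bad
sequence is combined with a hierarchy of cuts. Let S_i be the terms of `admissible base i` that are
built by passing at level i; `cut base i` holds the degrees c such that all members of S_i below c
are accessible in S_i. Admissibility at n restricts the degrees of levels j < n, outside
passed-through occurrences, to these cuts.

With all three levels restricted, second arguments in a minimal bad sequence t_n are accessible, so
the degrees (level, first argument) decrease and the level settles at some i. In the first
arguments, replace accessible subterms by ordinals, preserving order and not raising constants
(`exists_strictMono_constants`, `Hull.collapse_lt_iff`, `Hull.collapse_le`). This removes the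
subterms below t_n, so only passthrough remains: the images descend forever in S_i, below a degree
lying in the cut, which is impossible (`false_of_minimal_bad`).

The restrictions are then lifted one level at a time: if admissible terms at i + 1 are well-founded,
they all lie in the cut at i (`admissible_succ_subset_cut`), so the restriction at level i is
vacuous. With no restriction left, admissible means standard. -/

@[simp] theorem lt_const_const {x y : K} : lt (const x) (const y) ↔ x < y := by
  rw [lt]

@[simp] theorem lt_const_C {x : K} {i : Fin 3} {a b : Term K} : lt (const x) (C i a b) := by
  rw [lt]; trivial

@[simp] theorem not_lt_C_const {x : K} {i : Fin 3} {a b : Term K} : ¬ lt (C i a b) (const x) := by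
  rw [lt]; exact id

theorem lt_C_C {i j : Fin 3} {a b c d : Term K} :
    lt (C i a b) (C j c d) ↔
      le (C i a b) d ∨ (¬ le (C j c d) b ∧ (i < j ∨ (i = j ∧ lt a c))) := by
  rw [lt]; rfl

theorem lt_C_right (i : Fin 3) (a b : Term K) : lt b (C i a b) := by
  cases b with
  | const k => simp
  | C j c d => exact lt_C_C.2 (Or.inl (Or.inl rfl))

/-- The order properties of `lt` on standard terms of size at most `n`. -/
theorem linear_aux (base : K) (n : ℕ) :
    (∀ s t : Term K, Standard base s → Standard base t → sizeOf s ≤ n → sizeOf t ≤ n →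
      lt s t ∨ s = t ∨ lt t s) ∧
    (∀ r s t : Term K, Standard base r → Standard base s → Standard base t →
      sizeOf r ≤ n → sizeOf s ≤ n → sizeOf t ≤ n → lt r s → lt s t → lt r t) ∧
    (∀ t : Term K, Standard base t → sizeOf t ≤ n → ¬ lt t t) := by
  induction n with
  | zero =>
    refine ⟨fun s _ _ _ h _ => ?_, fun r _ _ _ _ _ h _ _ => ?_, fun t _ h => ?_⟩
    · cases s <;> simp at h
    · cases r <;> simp at h
    · cases t <;> simp at h
  | succ n ih =>
    obtain ⟨itri, itrans, iirr⟩ := ih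
    -- The inner induction on total size is needed because a whole term gets compared with the
    -- second argument of the other.
    have tri : ∀ m, ∀ s t : Term K, sizeOf s + sizeOf t ≤ m → Standard base s → Standard base t →
        sizeOf s ≤ n + 1 → sizeOf t ≤ n + 1 → lt s t ∨ s = t ∨ lt t s := by
      intro m
      induction m with
      | zero => intro s t h; cases s <;> simp at h
      | succ m ihm =>
        intro s t hm hs ht hsn htn
        cases hs with
        | const k =>
          cases ht with
          | const l => simpa using lt_trichotomy k l
          | C _ _ _ _ => simp
        | @C i a b ha hb hb2 _ =>
          cases ht with
          | const l => simp
          | @C j c d hc hd hd2 _ =>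
            have hs' : Standard base (C i a b) := Standard.C ha hb hb2 ‹_›
            have ht' : Standard base (C j c d) := Standard.C hc hd hd2 ‹_›
            simp only [Term.C.sizeOf_spec, Fin.sizeOf] at hm hsn htn
            by_cases h1 : le (C i a b) d
            · exact Or.inl (lt_C_C.2 (Or.inl h1))
            by_cases h2 : le (C j c d) b
            · exact Or.inr (Or.inr (lt_C_C.2 (Or.inl h2)))
            rcases lt_trichotomy i j with hij | hij | hij
            · exact Or.inl (lt_C_C.2 (Or.inr ⟨h2, Or.inl hij⟩))
            · subst hij
              rcases itri a c ha hc (by omega) (by omega) with hac | hac | hac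
              · exact Or.inl (lt_C_C.2 (Or.inr ⟨h2, Or.inr ⟨rfl, hac⟩⟩))
              · subst hac
                -- Standardness makes the degree of a compound d at least (i, a), so d cannot lie
                -- below C_i(a, b) when b < d. Hence equal degrees force equal second arguments.
                have key : ∀ b d : Term K, Standard base b → Standard base d →
                    sizeOf b ≤ n → sizeOf d ≤ n →
                    (b = .const base ∨ ∃ (j : Fin 3) (c d : Term K), b = .C j c d ∧ degLE i a j c) →
                    (d = .const base ∨ ∃ (j : Fin 3) (c' d' : Term K),
                      d = .C j c' d' ∧ degLE i a j c') →
                    lt b d → ¬ lt d (C i a b) := by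
                  intro b d hb hd hbn hdn hb2 hd2 hbd hdr
                  rcases hd2 with rfl | ⟨k, e, f, rfl, hdeg⟩
                  · rcases hb2 with rfl | ⟨k, e, f, rfl, _⟩
                    · simp at hbd
                    · simp at hbd
                  · rcases lt_C_C.1 hdr with hle | ⟨_, hlex⟩
                    · rcases hle with rfl | hle
                      · exact iirr _ hb hbn hbd
                      · exact iirr _ hb hbn (itrans _ _ _ hb hd hb hbn hdn hbn hbd hle)
                    · have he : Standard base e := by cases hd; assumption
                      simp only [Term.C.sizeOf_spec, Fin.sizeOf] at hdn
                      rcases hdeg with h | ⟨rfl, h⟩ <;> rcases hlex with h' | ⟨h'', h'⟩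
                      · exact absurd h h'.asymm
                      · subst h''; exact lt_irrefl _ h
                      · exact lt_irrefl _ h'
                      · rcases h with rfl | h
                        · exact iirr _ ha (by omega) h'
                        · exact iirr _ ha (by omega)
                            (itrans _ _ _ ha he ha (by omega) (by omega) (by omega) h h')
                rcases itri b d hb hd (by omega) (by omega) with hbd | hbd | hbd
                · exfalso
                  refine key b d hb hd (by omega) (by omega) hb2 hd2 hbd ?_
                  rcases ihm d (C i a b) (by simp only [Term.C.sizeOf_spec, Fin.sizeOf]; omega) hd
                    hs' (by omega) (by simp only [Term.C.sizeOf_spec, Fin.sizeOf]; omega)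
                    with h | h | h
                  · exact h
                  · exact absurd (Or.inl h.symm) h1
                  · exact absurd (Or.inr h) h1
                · subst hbd; exact Or.inr (Or.inl rfl)
                · exfalso
                  refine key d b hd hb (by omega) (by omega) hd2 hb2 hbd ?_
                  rcases ihm b (C i a d) (by simp only [Term.C.sizeOf_spec, Fin.sizeOf]; omega) hb
                    ht' (by omega) (by simp only [Term.C.sizeOf_spec, Fin.sizeOf]; omega)
                    with h | h | h
                  · exact h
                  · exact absurd (Or.inl h.symm) h2
                  · exact absurd (Or.inr h) h2
              · exact Or.inr (Or.inr (lt_C_C.2 (Or.inr ⟨h1, Or.inr ⟨rfl, hac⟩⟩)))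
            · exact Or.inr (Or.inr (lt_C_C.2 (Or.inr ⟨h1, Or.inl hij⟩)))
    have trans : ∀ m, ∀ r s t : Term K, sizeOf r + sizeOf s + sizeOf t ≤ m →
        Standard base r → Standard base s → Standard base t →
        sizeOf r ≤ n + 1 → sizeOf s ≤ n + 1 → sizeOf t ≤ n + 1 → lt r s → lt s t → lt r t := by
      intro m
      induction m with
      | zero => intro r s t h; cases r <;> simp at h
      | succ m ihm =>
        intro r s t hm hr hs ht hrn hsn htn hrs hst
        cases t with
        | const z =>
          cases s with
          | const y =>
            cases r with
            | const x =>
              rw [lt_const_const] at *; exact hrs.trans hst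
            | C _ _ _ => simp at hrs
          | C _ _ _ => simp at hst
        | C k e f =>
        cases r with
        | const x => simp
        | C i a b =>
        cases s with
        | const y => simp at hrs
        | C j c d =>
        have hb : Standard base b := by cases hr; assumption
        have ha : Standard base a := by cases hr; assumption
        have hc : Standard base c := by cases hs; assumption
        have hd : Standard base d := by cases hs; assumption
        have he : Standard base e := by cases ht; assumption
        have hf : Standard base f := by cases ht; assumption
        have e1 : sizeOf (C i a b) = 1 + i.val.succ + sizeOf a + sizeOf b := by simp [Fin.sizeOf]
        have e2 : sizeOf (C j c d) = 1 + j.val.succ + sizeOf c + sizeOf d := by simp [Fin.sizeOf]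
        have e3 : sizeOf (C k e f) = 1 + k.val.succ + sizeOf e + sizeOf f := by simp [Fin.sizeOf]
        rcases lt_C_C.1 hst with h1 | ⟨h1, h1'⟩
        · refine lt_C_C.2 (Or.inl (Or.inr ?_))
          rcases h1 with h1 | h1
          · rw [← h1]; exact hrs
          · exact ihm _ _ _ (by omega) hr hs hf hrn hsn (by omega) hrs h1
        · rcases lt_C_C.1 hrs with h2 | ⟨h2, h2'⟩
          · have hdt : lt d (C k e f) := by
              rcases tri _ d (C k e f) le_rfl hd ht (by omega) htn with h | h | h
              · exact h
              · exact absurd (Or.inl h.symm) h1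
              · exact absurd (Or.inr h) h1
            rcases h2 with h2 | h2
            · rw [h2]; exact hdt
            · exact ihm _ _ _ (by omega) hr hd ht hrn (by omega) htn h2 hdt
          · refine lt_C_C.2 (Or.inr ⟨fun h => h2 (Or.inr ?_), ?_⟩)
            · rcases h with h | h
              · rw [← h]; exact hst
              · exact ihm _ _ _ (by omega) hs ht hb hsn htn (by omega) hst h
            · rcases h1' with h1' | ⟨rfl, h1'⟩ <;> rcases h2' with h2' | ⟨rfl, h2'⟩
              · exact Or.inl (h2'.trans h1')
              · exact Or.inl h1'
              · exact Or.inl h2'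
              · exact Or.inr ⟨rfl, itrans _ _ _ ha hc he (by omega) (by omega) (by omega) h2' h1'⟩
    refine ⟨fun s t hs ht h1 h2 => tri _ s t le_rfl hs ht h1 h2,
      fun r s t hr hs ht h1 h2 h3 => trans _ r s t le_rfl hr hs ht h1 h2 h3, ?_⟩
    intro t ht htn htt
    cases t with
    | const k => simp at htt
    | C i a b =>
      have hb : Standard base b := by cases ht; assumption
      have ha : Standard base a := by cases ht; assumption
      have e1 : sizeOf (C i a b) = 1 + i.val.succ + sizeOf a + sizeOf b := by simp [Fin.sizeOf]
      rcases lt_C_C.1 htt with h | ⟨_, h⟩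
      · rcases h with h | h
        · have := congrArg sizeOf h; omega
        · exact iirr b hb (by omega) (trans _ _ _ _ le_rfl hb ht hb (by omega) htn (by omega)
            (lt_C_right i a b) h)
      · rcases h with h | ⟨_, h⟩
        · exact lt_irrefl _ h
        · exact iirr a ha (by omega) h

variable {base : K} {r s t : Term K}

theorem Standard.trichotomy (hs : Standard base s) (ht : Standard base t) :
    lt s t ∨ s = t ∨ lt t s :=
  (linear_aux base (sizeOf s + sizeOf t)).1 s t hs ht (by omega) (by omega)

theorem Standard.lt_trans (hr : Standard base r) (hs : Standard base s) (ht : Standard base t)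
    (h : lt r s) (h' : lt s t) : lt r t :=
  (linear_aux base (sizeOf r + sizeOf s + sizeOf t)).2.1 r s t hr hs ht
    (by omega) (by omega) (by omega) h h'

theorem Standard.irrefl (ht : Standard base t) : ¬ lt t t :=
  (linear_aux base (sizeOf t)).2.2 t ht le_rfl

theorem Standard.asymm (hs : Standard base s) (ht : Standard base t) (h : lt s t) : ¬ lt t s :=
  fun h' => hs.irrefl (hs.lt_trans ht hs h h')

theorem Standard.not_le_of_lt (hs : Standard base s) (ht : Standard base t) (h : lt s t) :
    ¬ le t s := by
  rintro (rfl | h')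
  · exact hs.irrefl h
  · exact hs.asymm ht h h'

theorem Standard.le_of_not_lt (hs : Standard base s) (ht : Standard base t) (h : ¬ lt s t) :
    le t s := by
  rcases hs.trichotomy ht with h' | h' | h'
  · exact absurd h' h
  · exact Or.inl h'.symm
  · exact Or.inr h'

theorem Standard.lt_of_not_le (hs : Standard base s) (ht : Standard base t) (h : ¬ le s t) :
    lt t s := by
  rcases hs.trichotomy ht with h' | h' | h'
  · exact absurd (Or.inr h') h
  · exact absurd (Or.inl h') h
  · exact h'

theorem Standard.lt_of_lt_of_le (hr : Standard base r) (hs : Standard base s)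
    (ht : Standard base t) (h : lt r s) (h' : le s t) : lt r t := by
  rcases h' with rfl | h'
  · exact h
  · exact hr.lt_trans hs ht h h'

theorem Standard.lt_of_le_of_lt (hr : Standard base r) (hs : Standard base s)
    (ht : Standard base t) (h : le r s) (h' : lt s t) : lt r t := by
  rcases h with rfl | h
  · exact h'
  · exact hr.lt_trans hs ht h h'

theorem Standard.left {i : Fin 3} {a b : Term K} (h : Standard base (Term.C i a b)) :
    Standard base a := by
  cases h; assumption

theorem Standard.right {i : Fin 3} {a b : Term K} (h : Standard base (Term.C i a b)) :
    Standard base b := by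
  cases h; assumption

theorem Standard.right_cases {i : Fin 3} {a b : Term K} (h : Standard base (Term.C i a b)) :
    b = .const base ∨ ∃ (j : Fin 3) (c d : Term K), b = .C j c d ∧ degLE i a j c := by
  cases h; assumption

theorem Standard.builtFromBelow {i : Fin 3} {a b : Term K} (h : Standard base (Term.C i a b)) :
    BuiltFromBelow i a (Term.C i a b) := by
  cases h; assumption

/-- The second argument of a standard term is determined by its degree among the candidates below
the term. -/
theorem Standard.not_lt_of_lt_right {i : Fin 3} {a b d : Term K} (hb : Standard base (Term.C i a b))
    (hd : Standard base (Term.C i a d)) (hbd : lt b d) : ¬ lt d (Term.C i a b) := by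
  intro h
  rcases hd.right_cases with rfl | ⟨k, e, f, rfl, hdeg⟩
  · rcases hb.right_cases with rfl | ⟨k, e, f, rfl, _⟩ <;> simp at hbd
  · rcases lt_C_C.1 h with hle | ⟨_, hlex⟩
    · exact hb.right.not_le_of_lt hd.right hbd hle
    · rcases hdeg with h1 | ⟨rfl, h1⟩ <;> rcases hlex with h' | ⟨h'', h'⟩
      · exact absurd h1 h'.asymm
      · subst h''; exact lt_irrefl _ h1
      · exact lt_irrefl _ h'
      · exact hd.right.left.not_le_of_lt hb.left h' h1

/-- `C_i(a, b)` is monotone in both arguments. -/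
theorem Standard.C_le_C {i : Fin 3} {a b a' b' : Term K} (h : Standard base (Term.C i a b))
    (h' : Standard base (Term.C i a' b')) (ha : le a' a) (hb : le b' b) :
    le (Term.C i a' b') (Term.C i a b) := by
  by_cases h1 : le (Term.C i a' b') b
  · exact Or.inr (lt_C_C.2 (Or.inl h1))
  have h2 : ¬ le (Term.C i a b) b' := h'.right.not_le_of_lt h
    (h'.right.lt_of_le_of_lt h.right h hb (lt_C_right i a b))
  rcases ha with rfl | ha
  · rcases hb with rfl | hb
    · exact Or.inl rfl
    · exact absurd (h'.lt_of_not_le h.right h1) (h'.not_lt_of_lt_right h hb)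
  · exact Or.inr (lt_C_C.2 (Or.inr ⟨h2, Or.inr ⟨rfl, ha⟩⟩))

end Order

end Term

end Passthrough

namespace Passthrough

namespace Term

/-! ### Occurrences of subterms and passthrough. -/

section Occurrence

variable {K : Type u} {a t y x : Term K} {i j : Fin 3} {c d : Term K} {p l : List (Term K)}

theorem IsOcc.trans (h : IsOcc a (y :: p)) (h' : IsOcc y l) : IsOcc a (l ++ p) := by
  induction h' with
  | root => exact h
  | left _ ih => exact ih.left
  | right _ ih => exact ih.right

theorem IsOcc.mem_cases (h : IsOcc a l) : ∃ q, l = q ++ [a] := by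
  induction h with
  | root => exact ⟨[], rfl⟩
  | @left j e f p _ ih => obtain ⟨q, hq⟩ := ih; exact ⟨e :: q, by simp [hq]⟩
  | @right j e f p _ ih => obtain ⟨q, hq⟩ := ih; exact ⟨f :: q, by simp [hq]⟩

theorem IsOcc.eq_or_sizeOf_lt (h : IsOcc a (y :: p)) : y = a ∨ sizeOf y < sizeOf a := by
  generalize hl : y :: p = l at h
  induction h generalizing y p with
  | root => simp at hl; exact Or.inl hl.1
  | @left j e f q _ ih =>
    simp only [List.cons.injEq] at hl
    have : sizeOf e < sizeOf (C j e f) := by simp; omega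
    rcases ih rfl with h | h
    · rw [hl.1, ← h]; exact Or.inr this
    · rw [hl.1]; exact Or.inr (this.trans h)
  | @right j e f q _ ih =>
    simp only [List.cons.injEq] at hl
    have : sizeOf f < sizeOf (C j e f) := by simp
    rcases ih rfl with h | h
    · rw [hl.1, ← h]; exact Or.inr this
    · rw [hl.1]; exact Or.inr (this.trans h)

theorem IsOcc.sizeOf_le (h : IsOcc a (y :: p)) : sizeOf y ≤ sizeOf a := by
  rcases h.eq_or_sizeOf_lt with rfl | h
  · exact le_rfl
  · exact h.le

theorem IsOcc.standard [LT K] {base : K} (ha : Standard base a) (h : IsOcc a l) :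
    ∀ z ∈ l, Standard base z := by
  induction h with
  | root => simpa using ha
  | @left j e f q _ ih =>
    intro z hz
    rcases List.mem_cons.1 hz with rfl | hz
    · cases ih _ List.mem_cons_self; assumption
    · exact ih z hz
  | @right j e f q _ ih =>
    intro z hz
    rcases List.mem_cons.1 hz with rfl | hz
    · cases ih _ List.mem_cons_self; assumption
    · exact ih z hz

theorem isOcc_const {k : K} (h : IsOcc (const k) l) : l = [const k] := by
  induction h with
  | root => rfl
  | left _ ih => simp at ih
  | right _ ih => simp at ih

theorem isOcc_C (h : IsOcc (C i c d) l) :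
    l = [C i c d] ∨ ∃ q, (IsOcc c q ∨ IsOcc d q) ∧ l = q ++ [C i c d] := by
  induction h with
  | root => exact Or.inl rfl
  | @left j e f p _ ih =>
    right
    rcases ih with h | ⟨q, hq, h⟩
    · simp only [List.cons.injEq, Term.C.injEq] at h
      obtain ⟨⟨rfl, rfl, rfl⟩, rfl⟩ := h
      exact ⟨[e], Or.inl .root, rfl⟩
    · rcases q with _ | ⟨x, q⟩
      · rcases hq with hq | hq <;> cases hq
      · simp only [List.cons_append, List.cons.injEq] at h
        obtain ⟨rfl, rfl⟩ := h
        exact ⟨e :: C j e f :: q, hq.imp .left .left, rfl⟩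
  | @right j e f p _ ih =>
    right
    rcases ih with h | ⟨q, hq, h⟩
    · simp only [List.cons.injEq, Term.C.injEq] at h
      obtain ⟨⟨rfl, rfl, rfl⟩, rfl⟩ := h
      exact ⟨[f], Or.inr .root, rfl⟩
    · rcases q with _ | ⟨x, q⟩
      · rcases hq with hq | hq <;> cases hq
      · simp only [List.cons_append, List.cons.injEq] at h
        obtain ⟨rfl, rfl⟩ := h
        exact ⟨f :: C j e f :: q, hq.imp .right .right, rfl⟩

/-- Countability is what lets the subterms of a whole sequence be collapsed into the ordinals of a
fixed universe. -/
theorem countable_subterms (a : Term K) : {y | ∃ p, IsOcc a (y :: p)}.Countable := by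
  induction a with
  | const k =>
    refine (Set.countable_singleton (const k)).mono ?_
    rintro y ⟨p, h⟩
    simpa using (List.cons.inj (isOcc_const h)).1
  | C i c d ihc ihd =>
    refine ((Set.countable_singleton (C i c d)).union (ihc.union ihd)).mono ?_
    rintro y ⟨p, h⟩
    rcases isOcc_C h with h | ⟨q, hq, h⟩
    · exact Or.inl (List.cons.inj h).1
    · right
      rcases q with _ | ⟨x, q⟩
      · rcases hq with hq | hq <;> cases hq
      · simp only [List.cons_append, List.cons.injEq] at h
        obtain ⟨rfl, rfl⟩ := h
        exact hq.imp (fun h => ⟨_, h⟩) (fun h => ⟨_, h⟩)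

/-- The occurrence `y :: p` is passed through at level `i`: it is a proper subterm of some
`z = C_j(e, f)`, `j < i`, and not in the scope of a subterm of `z` that is `< z`. -/
def Passing [LT K] (i : Fin 3) (y : Term K) (p : List (Term K)) : Prop :=
  ∃ (q : List (Term K)) (z : Term K) (r : List (Term K)),
    p = q ++ z :: r ∧ LevelBelow i z ∧ ∀ w ∈ y :: q, le z w

theorem Passing.mono [LT K] (hij : i ≤ j) (h : Passing i y p) : Passing j y p := by
  obtain ⟨q, z, r, hp, ⟨k, e, f, hz, hk⟩, hw⟩ := h
  exact ⟨q, z, r, hp, ⟨k, e, f, hz, hk.trans_le hij⟩, hw⟩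

/-- A term of level i cannot serve as the passing term at level i, so the passing term lies further
out. -/
theorem Passing.of_left [LT K] (h : Passing i c (C i c d :: p)) : Passing i (C i c d) p := by
  obtain ⟨q, z, r, hp, ⟨k, e, f, hz, hk⟩, hw⟩ := h
  rcases q with _ | ⟨x, q⟩
  · simp only [List.nil_append, List.cons.injEq] at hp
    rw [hz] at hp
    simp only [Term.C.injEq] at hp
    exact absurd hp.1.1.symm hk.ne
  · simp only [List.cons_append, List.cons.injEq] at hp
    obtain ⟨rfl, rfl⟩ := hp
    exact ⟨q, z, r, rfl, ⟨k, e, f, hz, hk⟩, fun w hw' => hw w (List.mem_cons_of_mem _ hw')⟩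

/-- An occurrence in an occurrence `y` that is passed through in the whole term is passed through
in `y`, or `y` itself is passed through, by the same term. -/
theorem Passing.of_append [LT K] (hy : IsOcc y (x :: l)) (h : Passing i x (l ++ p)) :
    Passing i x l ∨ Passing i y p := by
  obtain ⟨q, z, r, hp, hz, hw⟩ := h
  have hyl : y ∈ x :: l := by
    obtain ⟨q, hq⟩ := hy.mem_cases
    rw [hq]; simp
  rcases List.append_eq_append_iff.1 hp with ⟨a', hq, hp'⟩ | ⟨c', hl, hc'⟩
  · right
    refine ⟨a', z, r, hp', hz, fun w hw' => hw w ?_⟩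
    rw [hq]
    rcases List.mem_cons.1 hw' with rfl | hw'
    · exact List.mem_append_left a' hyl
    · exact List.mem_append_right (x :: l) hw'
  · rcases c' with _ | ⟨z', c'⟩
    · right
      simp only [List.nil_append, List.append_nil] at hc' hl
      subst hl
      refine ⟨[], z, r, hc'.symm, hz, fun w hw' => hw w ?_⟩
      simp only [List.mem_singleton] at hw'
      rw [hw']; exact hyl
    · left
      simp only [List.cons_append, List.cons.injEq] at hc'
      obtain ⟨rfl, rfl⟩ := hc'
      exact ⟨q, z, c', hl, hz, hw⟩

end Occurrence

/-! ### Collapsing a set of terms to constants. -/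

section Collapse

variable {K : Type u} {K' : Type v}

open Classical in
/-- Replace the outermost subterms lying in `P` by the constants given by `g`, and second arguments
lying in `P` by the base. -/
noncomputable def collapse (P : Set (Term K)) (g : Term K → K') (base' : K') : Term K → Term K'
  | const k => const (g (const k))
  | C i a b =>
    if C i a b ∈ P then const (g (C i a b))
    else C i (collapse P g base' a) (if b ∈ P then const base' else collapse P g base' b)

/-- Terms generated from `P` using only compound terms that are above `P`. -/
inductive Hull [LT K] (P : Set (Term K)) : Term K → Prop
  | mem {t : Term K} : t ∈ P → Hull P t
  | C {i : Fin 3} {a b : Term K} : Hull P a → Hull P b → C i a b ∉ P →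
      (∀ z ∈ P, lt z (C i a b)) → Hull P (C i a b)

variable {P : Set (Term K)} {g : Term K → K'} {base' : K'}

theorem collapse_of_mem {t : Term K} (h : t ∈ P) : collapse P g base' t = const (g t) := by
  cases t with
  | const k => rfl
  | C i a b => simp [collapse, h]

open Classical in
theorem collapse_of_notMem {i : Fin 3} {a b : Term K} (h : C i a b ∉ P) :
    collapse P g base' (C i a b) =
      C i (collapse P g base' a) (if b ∈ P then const base' else collapse P g base' b) := by
  simp [collapse, h]

variable [LinearOrder K] {base : K}

theorem Hull.exists_C {t : Term K} (h : Hull P t) (ht : t ∉ P) :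
    ∃ i a b, t = Term.C i a b ∧ Hull P a ∧ Hull P b ∧ ∀ z ∈ P, lt z t := by
  cases h with
  | mem h => exact absurd h ht
  | C ha hb _ hP => exact ⟨_, _, _, rfl, ha, hb, hP⟩

theorem Hull.not_lt {t z : Term K} (h : Hull P t) (ht : t ∉ P) (hz : z ∈ P)
    (hts : Standard base t) (hzs : Standard base z) : ¬ lt t z := by
  obtain ⟨i, a, b, rfl, _, _, hP⟩ := h.exists_C ht
  exact hzs.asymm hts (hP z hz)

/-- Occurrences in a collapsed term come from occurrences in the term, apart from constants. -/
theorem Hull.exists_isOcc {a : Term K} (ha : Hull P a) {l : List (Term K')}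
    (h : IsOcc (collapse P g base' a) l) :
    (∃ k p, l = const k :: p) ∨
      ∃ l', IsOcc a l' ∧ l = l'.map (collapse P g base') ∧ ∀ w ∈ l', Hull P w ∧ w ∉ P := by
  induction h with
  | root =>
    by_cases haP : a ∈ P
    · left; exact ⟨_, [], by rw [collapse_of_mem haP]⟩
    · exact Or.inr ⟨[a], .root, rfl, by simpa using ⟨ha, haP⟩⟩
  | @left j e f p _ ih =>
    rcases ih with ⟨k, p, h⟩ | ⟨l', hl', h, hw⟩
    · simp at h
    rcases l' with _ | ⟨w, l'⟩
    · simp at h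
    have hwm := hw w List.mem_cons_self
    obtain ⟨i, c, d, rfl, hc, hd, _⟩ := hwm.1.exists_C hwm.2
    have h0 := h
    rw [List.map_cons, collapse_of_notMem hwm.2] at h0
    simp only [List.cons.injEq, Term.C.injEq] at h0
    obtain ⟨⟨rfl, rfl, rfl⟩, rfl⟩ := h0
    by_cases hcP : c ∈ P
    · left; exact ⟨_, _, by rw [collapse_of_mem hcP]⟩
    · refine Or.inr ⟨c :: Term.C j c d :: l', hl'.left, by rw [h]; rfl, ?_⟩
      intro w hw'
      rcases List.mem_cons.1 hw' with rfl | hw'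
      · exact ⟨hc, hcP⟩
      · exact hw w hw'
  | @right j e f p _ ih =>
    rcases ih with ⟨k, p, h⟩ | ⟨l', hl', h, hw⟩
    · simp at h
    rcases l' with _ | ⟨w, l'⟩
    · simp at h
    have hwm := hw w List.mem_cons_self
    obtain ⟨i, c, d, rfl, hc, hd, _⟩ := hwm.1.exists_C hwm.2
    have h0 := h
    rw [List.map_cons, collapse_of_notMem hwm.2] at h0
    simp only [List.cons.injEq, Term.C.injEq] at h0
    obtain ⟨⟨rfl, rfl, rfl⟩, rfl⟩ := h0
    by_cases hdP : d ∈ P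
    · left; exact ⟨_, _, by rw [if_pos hdP]⟩
    · refine Or.inr ⟨d :: Term.C j c d :: l', hl'.right, ?_, ?_⟩
      · rw [h, if_neg hdP]; rfl
      intro w hw'
      rcases List.mem_cons.1 hw' with rfl | hw'
      · exact ⟨hd, hdP⟩
      · exact hw w hw'

variable [LinearOrder K']

/-- Sending all second arguments in `P` to the base loses nothing: they lie below the uncollapsed
compound terms, and `Standard.not_lt_of_lt_right` leaves only one such second argument for a given
degree. -/
theorem Hull.collapse_injective (hg : ∀ x ∈ P, ∀ y ∈ P, lt x y → g x < g y) {s t : Term K}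
    (hs : Hull P s) (ht : Hull P t) (hss : Standard base s) (hts : Standard base t)
    (h : collapse P g base' s = collapse P g base' t) : s = t := by
  induction hs generalizing t with
  | @mem s hsP =>
    rw [collapse_of_mem hsP] at h
    by_cases htP : t ∈ P
    · rw [collapse_of_mem htP] at h
      rcases hss.trichotomy hts with h' | h' | h'
      · exact absurd (Term.const.inj h) (hg _ hsP _ htP h').ne
      · exact h'
      · exact absurd (Term.const.inj h) (hg _ htP _ hsP h').ne'
    · obtain ⟨i, a, b, rfl, _⟩ := ht.exists_C htP
      rw [collapse_of_notMem htP] at h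
      simp at h
  | @C i a b ha hb hP hlt iha ihb =>
    rw [collapse_of_notMem hP] at h
    by_cases htP : t ∈ P
    · rw [collapse_of_mem htP] at h; simp at h
    · obtain ⟨j, c, d, rfl, hc, hd, hlt'⟩ := ht.exists_C htP
      rw [collapse_of_notMem htP] at h
      simp only [Term.C.injEq] at h
      obtain ⟨rfl, hac, hbd⟩ := h
      obtain rfl := iha hc hss.left hts.left hac
      by_cases hbP : b ∈ P <;> by_cases hdP : d ∈ P
      · rcases hss.right.trichotomy hts.right with h' | h' | h'
        · exact absurd (hlt d hdP) (hss.not_lt_of_lt_right hts h')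
        · rw [h']
        · exact absurd (hlt' b hbP) (hts.not_lt_of_lt_right hss h')
      · obtain ⟨k, e, f, rfl, _⟩ := hd.exists_C hdP
        rw [if_pos hbP, if_neg hdP, collapse_of_notMem hdP] at hbd
        simp at hbd
      · obtain ⟨k, e, f, rfl, _⟩ := hb.exists_C hbP
        rw [if_pos hdP, if_neg hbP, collapse_of_notMem hbP] at hbd
        simp at hbd
      · rw [if_neg hbP, if_neg hdP] at hbd
        rw [ihb hd hss.right hts.right hbd]

theorem Hull.collapse_lt_iff (hg : ∀ x ∈ P, ∀ y ∈ P, lt x y → g x < g y) {s t : Term K}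
    (hs : Hull P s) (ht : Hull P t) (hss : Standard base s) (hts : Standard base t) :
    lt (collapse P g base' s) (collapse P g base' t) ↔ lt s t := by
  induction hn : sizeOf s + sizeOf t using Nat.strong_induction_on generalizing s t with
  | _ n ih =>
  by_cases hsP : s ∈ P
  · rw [collapse_of_mem hsP]
    by_cases htP : t ∈ P
    · rw [collapse_of_mem htP, lt_const_const]
      refine ⟨fun h => ?_, hg s hsP t htP⟩
      rcases hss.trichotomy hts with h' | h' | h'
      · exact h'
      · rw [h'] at h; exact absurd h (lt_irrefl _)
      · exact absurd h (hg t htP s hsP h').asymm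
    · obtain ⟨j, c, d, rfl, _, _, hlt⟩ := ht.exists_C htP
      rw [collapse_of_notMem htP]
      simp [hlt s hsP]
  · obtain ⟨i, a, b, rfl, ha, hb, hlt⟩ := hs.exists_C hsP
    by_cases htP : t ∈ P
    · rw [collapse_of_mem htP, collapse_of_notMem hsP]
      simp [hs.not_lt hsP htP hss hts]
    · obtain ⟨j, c, d, rfl, hc, hd, hlt'⟩ := ht.exists_C htP
      have e1 : sizeOf (Term.C i a b) = 1 + i.val.succ + sizeOf a + sizeOf b := by
        simp [Fin.sizeOf]
      have e2 : sizeOf (Term.C j c d) = 1 + j.val.succ + sizeOf c + sizeOf d := by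
        simp [Fin.sizeOf]
      -- If y is in `P`, both sides are false, so it does not matter that y is replaced by the base
      -- rather than by its own constant.
      have key : ∀ {x y : Term K}, Hull P x → Hull P y → Standard base x → Standard base y →
          x ∉ P → sizeOf x + sizeOf y < n →
          (le (collapse P g base' x) (open Classical in if y ∈ P then const base' else
            collapse P g base' y) ↔ le x y) := by
        intro x y hx hy hxs hys hxP hxy
        obtain ⟨k, e, f, rfl, _, _, hltx⟩ := hx.exists_C hxP
        by_cases hyP : y ∈ P
        · rw [if_pos hyP, collapse_of_notMem hxP]
          refine iff_of_false ?_ (hys.not_le_of_lt hxs (hltx y hyP))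
          simp [le]
        · rw [if_neg hyP]
          refine or_congr ⟨hx.collapse_injective hg hy hxs hys, fun h => by rw [h]⟩
            (ih _ hxy hx hy hxs hys rfl)
      have h1 := key hs hd hss hts.right hsP (by omega)
      have h2 := key ht hb hts hss.right htP (by omega)
      have h3 := ih _ (by omega) ha hc hss.left hts.left rfl
      rw [lt_C_C, ← h1, ← h2, ← h3, collapse_of_notMem hsP, collapse_of_notMem htP, lt_C_C]

theorem Hull.collapse_le_iff (hg : ∀ x ∈ P, ∀ y ∈ P, lt x y → g x < g y) {s t : Term K}
    (hs : Hull P s) (ht : Hull P t) (hss : Standard base s) (hts : Standard base t) :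
    le (collapse P g base' s) (collapse P g base' t) ↔ le s t :=
  or_congr ⟨hs.collapse_injective hg ht hss hts, fun h => by rw [h]⟩
    (hs.collapse_lt_iff hg ht hss hts)

/-- Occurrences above a collapsed term come from occurrences above the term. -/
theorem Hull.exists_isOcc_of_lt (hg : ∀ x ∈ P, ∀ y ∈ P, lt x y → g x < g y) {a : Term K}
    (ha : Hull P a) (has : Standard base a) {y' : Term K'} {p' : List (Term K')}
    (h : IsOcc (collapse P g base' a) (y' :: p')) (hlt : lt (collapse P g base' a) y') :
    ∃ y p, IsOcc a (y :: p) ∧ lt a y ∧ y' = collapse P g base' y ∧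
      p' = p.map (collapse P g base') ∧ ∀ w ∈ y :: p, Hull P w ∧ w ∉ P := by
  rcases ha.exists_isOcc h with ⟨k, p, hk⟩ | ⟨l, hl, h', hw⟩
  · obtain ⟨rfl, rfl⟩ := List.cons.inj hk
    by_cases haP : a ∈ P
    · rw [collapse_of_mem haP] at h hlt
      have := isOcc_const h
      rw [(List.cons.inj this).1] at hlt
      simp at hlt
    · obtain ⟨i, c, d, rfl, _⟩ := ha.exists_C haP
      rw [collapse_of_notMem haP] at hlt
      simp at hlt
  · rcases l with _ | ⟨y, p⟩
    · simp at h'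
    · obtain ⟨rfl, rfl⟩ := List.cons.inj h'
      have hy := hw y List.mem_cons_self
      refine ⟨y, p, hl, ?_, rfl, rfl, hw⟩
      exact (ha.collapse_lt_iff hg hy.1 has (hl.standard has y List.mem_cons_self)).1 hlt

theorem Hull.passing_collapse (hg : ∀ x ∈ P, ∀ y ∈ P, lt x y → g x < g y) {i : Fin 3} {y : Term K}
    {p : List (Term K)} (hw : ∀ w ∈ y :: p, Hull P w ∧ w ∉ P)
    (hs : ∀ w ∈ y :: p, Standard base w) (h : Passing i y p) :
    Passing i (collapse P g base' y) (p.map (collapse P g base')) := by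
  obtain ⟨q, z, r, rfl, ⟨j, e, f, rfl, hj⟩, hle⟩ := h
  have hz : Term.C j e f ∈ y :: (q ++ Term.C j e f :: r) := by simp
  refine ⟨q.map (collapse P g base'), collapse P g base' (Term.C j e f),
    r.map (collapse P g base'), by simp,
    ⟨j, _, _, collapse_of_notMem (hw _ hz).2, hj⟩, ?_⟩
  rw [← List.map_cons]
  intro w' hw'
  obtain ⟨w, hwq, rfl⟩ := List.mem_map.1 hw'
  have hwm : w ∈ y :: (q ++ Term.C j e f :: r) := by
    simp only [List.mem_cons, List.mem_append] at hwq ⊢; tauto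
  exact ((hw _ hz).1.collapse_le_iff hg (hw w hwm).1 (hs _ hz) (hs w hwm)).2 (hle w hwq)

theorem Hull.standard_collapse (hg : ∀ x ∈ P, ∀ y ∈ P, lt x y → g x < g y) {t : Term K}
    (ht : Hull P t) (hts : Standard base t) : Standard base' (collapse P g base' t) := by
  induction ht with
  | mem h => rw [collapse_of_mem h]; exact .const _
  | @C i a b ha hb hP hlt iha ihb =>
    have ht : Hull P (Term.C i a b) := .C ha hb hP hlt
    have hcol := collapse_of_notMem (g := g) (base' := base') hP
    rw [hcol]
    refine .C (iha hts.left) ?_ ?_ ?_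
    · split_ifs with hbP
      · exact .const _
      · exact ihb hts.right
    · by_cases hbP : b ∈ P
      · rw [if_pos hbP]; exact Or.inl rfl
      · rw [if_neg hbP]
        right
        obtain ⟨j, c, d, rfl, hc, hd, _⟩ := hb.exists_C hbP
        refine ⟨j, _, _, collapse_of_notMem hbP, ?_⟩
        rcases hts.right_cases with h | ⟨j', c', d', h, hdeg⟩
        · simp at h
        · simp only [Term.C.injEq] at h
          obtain ⟨rfl, rfl, rfl⟩ := h
          exact hdeg.imp_right (And.imp_right
            (ha.collapse_le_iff hg hc hts.left hts.right.left).2)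
    · rw [← hcol]
      intro y' p' hocc hlt'
      obtain ⟨y, p, ho, hay, rfl, rfl, hw⟩ := ha.exists_isOcc_of_lt hg hts.left hocc hlt'
      have hst := ho.standard hts.left
      rcases hts.builtFromBelow y p ho hay with ⟨z, hz, hzt⟩ | hpass
      · left
        refine ⟨collapse P g base' z, ?_, ?_⟩
        · rw [← List.map_cons]; exact List.mem_map_of_mem hz
        · exact ((hw z hz).1.collapse_lt_iff hg ht (hst z hz) hts).2 hzt
      · right
        exact Hull.passing_collapse hg hw hst hpass

end Collapse

section CollapseLe

variable {K : Type u} [LinearOrder K] {base : K} {P : Set (Term K)}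

/-- By monotonicity of C_i in both arguments. Since cuts are closed downwards, collapsed degrees
stay in the cuts. -/
theorem Hull.collapse_le {g : Term K → K} (hg : ∀ x ∈ P, ∀ y ∈ P, lt x y → g x < g y)
    (hk : ∀ k, const k ∈ P → g (const k) ≤ k) {t : Term K}
    (ht : Hull P t) (hts : Standard base t) : le (collapse P g base t) t := by
  have hst := ht.standard_collapse (base' := base) hg hts
  induction ht with
  | @mem t h =>
    rw [collapse_of_mem h]
    cases t with
    | const k =>
      rcases (hk k h).eq_or_lt with h | h
      · rw [h]; exact Or.inl rfl
      · exact Or.inr (lt_const_const.2 h)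
    | C _ _ _ => exact Or.inr lt_const_C
  | @C i a b ha hb hP hlt iha ihb =>
    rw [collapse_of_notMem hP] at hst ⊢
    refine hts.C_le_C hst (iha hts.left (ha.standard_collapse hg hts.left)) ?_
    by_cases hbP : b ∈ P
    · rw [if_pos hbP]
      rcases hts.right_cases with rfl | ⟨j, c, d, rfl, _⟩
      · exact Or.inl rfl
      · exact Or.inr lt_const_C
    · rw [if_neg hbP]
      exact ihb hts.right (hb.standard_collapse hg hts.right)

end CollapseLe

end Term

end Passthrough

namespace Passthrough

namespace Term

/-! ### Cuts, admissible terms, and lifting the restrictions. -/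

section Cuts

variable {K : Type u}

/-- Accessibility of `t` for the order restricted to `S`. -/
def AccOn [LT K] (S : Set (Term K)) (t : Term K) : Prop :=
  Acc (fun x y => x ∈ S ∧ lt x y) t

/-- Built from below using passthrough only. -/
def BuiltByPassing [LT K] (i : Fin 3) (a : Term K) : Prop :=
  ∀ (y : Term K) (p : List (Term K)), IsOcc a (y :: p) → lt a y → Passing i y p

/-- The degrees at level `i` below which the terms built by passing, with lower degrees restricted
to the lower cuts, are well-founded. -/
def cut [LT K] (base : K) (i : Fin 3) : Set (Term K) :=
  {c | ∀ a ∈ {a | (Standard base a ∧ ∀ j : Fin 3, j.val < i.val → ∀ c d p,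
        IsOcc a (C j c d :: p) → ¬ Passing j (C j c d) p → c ∈ cut base j) ∧ BuiltByPassing i a},
      lt a c →
      AccOn {a | (Standard base a ∧ ∀ j : Fin 3, j.val < i.val → ∀ c d p,
        IsOcc a (C j c d :: p) → ¬ Passing j (C j c d) p → c ∈ cut base j) ∧ BuiltByPassing i a} a}
termination_by i.val

/-- Standard terms whose occurrences of `C_j`, `j < n`, that are not passed through have degrees in
the cuts. -/
def admissible [LT K] (base : K) (n : ℕ) : Set (Term K) :=
  {t | Standard base t ∧ ∀ j : Fin 3, j.val < n → ∀ c d p,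
    IsOcc t (C j c d :: p) → ¬ Passing j (C j c d) p → c ∈ cut base j}

variable [LinearOrder K] {base : K}

theorem mem_cut {i : Fin 3} {c : Term K} :
    c ∈ cut base i ↔ ∀ a ∈ {a | a ∈ admissible base i ∧ BuiltByPassing i a}, lt a c →
      AccOn {a | a ∈ admissible base i ∧ BuiltByPassing i a} a := by
  rw [cut]; rfl

theorem AccOn.mono {S S' : Set (Term K)} (h : S' ⊆ S) {t : Term K} (ht : AccOn S t) :
    AccOn S' t :=
  Subrelation.accessible (fun {_ _} hxy => ⟨h hxy.1, hxy.2⟩) ht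

theorem AccOn.inv {S : Set (Term K)} {s t : Term K} (ht : AccOn S t) (hs : s ∈ S)
    (h : le s t) : AccOn S s := by
  rcases h with rfl | h
  · exact ht
  · exact Acc.inv ht ⟨hs, h⟩

theorem not_accOn_of_decreasing {S : Set (Term K)} {x : ℕ → Term K} (hS : ∀ n, x n ∈ S)
    (hx : ∀ n, lt (x (n + 1)) (x n)) (n : ℕ) : ¬ AccOn S (x n) := by
  intro h
  generalize ht : x n = t at h
  induction h generalizing n with
  | intro t _ ih => exact ih _ ⟨hS (n + 1), ht ▸ hx n⟩ (n + 1) rfl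

theorem accOn_const [WellFoundedLT K] (S : Set (Term K)) (k : K) : AccOn S (const k) := by
  induction k using WellFoundedLT.induction with
  | _ k ih =>
    refine Acc.intro _ ?_
    rintro (l | ⟨_, _, _⟩) ⟨_, h⟩
    · exact ih l (by simpa using h)
    · simp at h

theorem mem_cut_of_le {i : Fin 3} {c c' : Term K} (hc : c ∈ cut base i) (h : le c' c)
    (hs : Standard base c) (hs' : Standard base c') : c' ∈ cut base i :=
  mem_cut.2 fun a ha hac => mem_cut.1 hc a ha (ha.1.1.lt_of_lt_of_le hs' hs hac h)

/-- Subterms that are not passed through inherit admissibility. -/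
theorem mem_admissible_of_isOcc {n : ℕ} {t y : Term K} {p : List (Term K)}
    (ht : t ∈ admissible base n) (h : IsOcc t (y :: p))
    (hp : ∀ j : Fin 3, j.val < n → ¬ Passing j y p) : y ∈ admissible base n := by
  refine ⟨h.standard ht.1 y List.mem_cons_self, fun j hj c d l hl hnp => ?_⟩
  exact ht.2 j hj c d _ (h.trans hl) fun hpass =>
    (hpass.of_append hl).elim hnp (hp j hj)

/-- A minimal bad sequence. -/
theorem exists_minimal_bad {S : Set (Term K)} (hS : ∀ t ∈ S, Standard base t) {t : Term K}
    (ht : t ∈ S) (hta : ¬ AccOn S t) :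
    ∃ f : ℕ → Term K, (∀ n, f n ∈ S) ∧ (∀ n, ¬ AccOn S (f n)) ∧ (∀ n, lt (f (n + 1)) (f n)) ∧
      ∀ n, ∀ s ∈ S, lt s (f n) → sizeOf s < sizeOf (f n) → AccOn S s := by
  have step : ∀ t : {t // t ∈ S ∧ ¬ AccOn S t}, ∃ s : {t // t ∈ S ∧ ¬ AccOn S t},
      lt s.1 t.1 ∧ ∀ r ∈ S, lt r s.1 → sizeOf r < sizeOf s.1 → AccOn S r := by
    rintro ⟨t, ht, hta⟩
    have hne : {s | s ∈ S ∧ lt s t ∧ ¬ AccOn S s}.Nonempty := by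
      by_contra hne
      refine hta (Acc.intro _ fun s hs => ?_)
      by_contra hsa
      exact hne ⟨s, hs.1, hs.2, hsa⟩
    obtain ⟨s, ⟨hs, hst, hsa⟩, hmin⟩ := (measure (sizeOf : Term K → ℕ)).wf.has_min _ hne
    refine ⟨⟨s, hs, hsa⟩, hst, fun r hr hrs hsize => ?_⟩
    by_contra hra
    exact hmin r ⟨hr, (hS r hr).lt_trans (hS s hs) (hS t ht) hrs hst, hra⟩ hsize
  choose F hF using step
  refine ⟨fun n => (F^[n + 1] ⟨t, ht, hta⟩).1, fun n => (F^[n + 1] _).2.1,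
    fun n => (F^[n + 1] _).2.2, fun n => ?_, fun n => ?_⟩
  · beta_reduce
    rw [Function.iterate_succ_apply' F (n + 1)]
    exact (hF _).1
  · beta_reduce
    rw [Function.iterate_succ_apply' F n]
    exact (hF _).2

/-- If the admissible terms at level `i + 1` are well-founded, then their degrees lie in the
cut at level `i`. -/
theorem admissible_succ_subset_cut (i : Fin 3)
    (hwf : ∀ t ∈ admissible base (i.val + 1), AccOn (admissible base (i.val + 1)) t) :
    admissible base (i.val + 1) ⊆ cut base i := by
  intro t ht
  have hta := hwf t ht
  induction hta with
  | intro m _ ih =>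
  by_contra hm
  have ih' : ∀ s ∈ admissible base (i.val + 1), lt s m → s ∈ cut base i :=
    fun s hs hsm => ih s ⟨hs, hsm⟩ hs
  rw [mem_cut] at hm
  push Not at hm
  obtain ⟨a, ha, ham, haa⟩ := hm
  -- Membership in the cut would make all of S_i below a accessible, and therefore a itself.
  have hac : a ∉ cut base i := fun h => haa <| Acc.intro _ fun s hs => mem_cut.1 h s hs.1 hs.2
  -- Minimality puts the relevant level-i degrees inside y into the cut, which makes y admissible at
  -- i + 1.
  obtain ⟨y, ⟨p, hocc, hnp, hyc⟩, hmin⟩ := (measure (sizeOf : Term K → ℕ)).wf.has_min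
    {y | ∃ p, IsOcc a (y :: p) ∧ ¬ Passing i y p ∧ y ∉ cut base i}
    ⟨a, [], .root, fun ⟨q, z, r, h, _⟩ => by simp at h, hac⟩
  have hys : Standard base y := hocc.standard ha.1.1 y List.mem_cons_self
  have hyadm : y ∈ admissible base (i.val + 1) := by
    refine ⟨hys, fun j hj c d l hl hnl => ?_⟩
    rcases Nat.lt_succ_iff_lt_or_eq.1 hj with hj | hj
    · exact (mem_admissible_of_isOcc ha.1 hocc
        fun j hj hp => hnp (hp.mono (Fin.le_def.2 hj.le))).2 j hj c d l hl hnl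
    · obtain rfl := Fin.ext hj
      by_contra hc
      refine hmin c ⟨_, (hocc.trans hl).left, fun hp => ?_, hc⟩ ?_
      · exact (Passing.of_append hl hp.of_left).elim hnl hnp
      · have h1 := hl.sizeOf_le
        have h2 : sizeOf c < sizeOf (C j c d) := by simp; omega
        exact lt_of_lt_of_le h2 h1
  -- An occurrence above a would be passed through. So y ≤ a < m, and the induction hypothesis
  -- applies to y.
  have hya : le y a := ha.1.1.le_of_not_lt hys fun h => hnp (ha.2 y p hocc h)
  exact hyc (ih' y hyadm (hys.lt_of_le_of_lt ha.1.1 ht.1 hya ham))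

/-- By induction on size: a degree c at level i is a smaller term that inherits admissibility, so it
is admissible at i + 1 and hence in the cut. -/
theorem admissible_subset_succ (i : Fin 3)
    (hwf : ∀ t ∈ admissible base (i.val + 1), AccOn (admissible base (i.val + 1)) t) :
    admissible base i.val ⊆ admissible base (i.val + 1) := by
  intro t ht
  induction hn : sizeOf t using Nat.strong_induction_on generalizing t with
  | _ n ih =>
  refine ⟨ht.1, fun j hj c d p hocc hnp => ?_⟩
  rcases Nat.lt_succ_iff_lt_or_eq.1 hj with hj | hj
  · exact ht.2 j hj c d p hocc hnp
  · obtain rfl := Fin.ext hj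
    refine admissible_succ_subset_cut j hwf (ih (sizeOf c) ?_ ?_ rfl)
    · have h1 := hocc.sizeOf_le
      have h2 : sizeOf c < sizeOf (C j c d) := by simp; omega
      omega
    · exact mem_admissible_of_isOcc ht hocc.left
        fun k hk hp => hnp (hp.mono (Fin.le_def.2 hk.le)).of_left

theorem accOn_of_accOn_succ (i : Fin 3)
    (hwf : ∀ t ∈ admissible base (i.val + 1), AccOn (admissible base (i.val + 1)) t) :
    ∀ t ∈ admissible base i.val, AccOn (admissible base i.val) t :=
  fun t ht => (hwf t (admissible_subset_succ i hwf ht)).mono (admissible_subset_succ i hwf)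

end Cuts

/-! ### The minimal bad sequence over the ordinals. -/

section Ordinals

/-- A countable well-founded set of terms over the ordinals embeds into the ordinals, preserving
constants. -/
theorem exists_strictMono_constants {P : Set (Term Ordinal.{u})} (hP : P.Countable)
    (hacc : ∀ t ∈ P, AccOn P t) :
    ∃ g : Term Ordinal.{u} → Ordinal.{u}, (∀ x ∈ P, ∀ y ∈ P, lt x y → g x < g y) ∧
      ∀ k, const k ∈ P → g (const k) ≤ k := by
  rcases P.eq_empty_or_nonempty with rfl | hne
  · exact ⟨fun _ => 0, by simp, by simp⟩
  obtain ⟨e, rfl⟩ := hP.exists_eq_range hne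
  have hwf : WellFounded fun m n => lt (e m) (e n) := by
    refine ⟨fun n => ?_⟩
    have h := hacc (e n) ⟨n, rfl⟩
    generalize ht : e n = t at h
    induction h generalizing n with
    | intro t _ ih =>
      subst ht
      exact Acc.intro _ fun m hm => ih (e m) ⟨⟨m, rfl⟩, hm⟩ m rfl
  -- The successor puts the supremum σ strictly above every constant of the set; compound terms are
  -- then placed from σ on, according to rank.
  let val : Term Ordinal.{u} → Ordinal.{u} := fun t => match t with
    | const k => Order.succ k
    | C _ _ _ => 0
  let σ : Ordinal.{u} := ⨆ n, val (e n)
  have hσ : ∀ k, const k ∈ Set.range e → k < σ := by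
    rintro k ⟨n, hn⟩
    have h : val (e n) ≤ σ := Ordinal.le_iSup (fun n => val (e n)) n
    rw [hn] at h
    exact Order.succ_le_iff.1 h
  let idx : Term Ordinal.{u} → ℕ := Function.invFun e
  have hidx : ∀ t ∈ Set.range e, e (idx t) = t := fun t ht => Function.invFun_eq ht
  have : IsWellFounded ℕ fun m n => lt (e m) (e n) := ⟨hwf⟩
  let g : Term Ordinal.{u} → Ordinal.{u} := fun t => match t with
    | const k => k
    | C i a b => σ + Ordinal.lift.{u} (IsWellFounded.rank (fun m n => lt (e m) (e n))
        (idx (C i a b)))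
  refine ⟨g, ?_, fun k _ => le_rfl⟩
  rintro (k | ⟨i, a, b⟩) hx (l | ⟨j, c, d⟩) hy h
  · simpa using h
  · exact (hσ k hx).trans_le le_self_add
  · simp at h
  · refine add_lt_add_right (Ordinal.lift_lt.2 (IsWellFounded.rank_lt_of_rel ?_)) σ
    rw [hidx _ hx, hidx _ hy]; exact h

/-- There is no minimal bad sequence of admissible terms with constant level. -/
theorem false_of_minimal_bad {base : Ordinal.{u}} {i : Fin 3} {a b : ℕ → Term Ordinal.{u}}
    (hadm : ∀ n, C i (a n) (b n) ∈ admissible base 3)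
    (hbad : ∀ n, ¬ AccOn (admissible base 3) (C i (a n) (b n)))
    (hmin : ∀ n, ∀ s ∈ admissible base 3, lt s (C i (a n) (b n)) →
      sizeOf s < sizeOf (C i (a n) (b n)) → AccOn (admissible base 3) s)
    (hdec : ∀ n, lt (a (n + 1)) (a n)) : False := by
  set t : ℕ → Term Ordinal.{u} := fun n => C i (a n) (b n) with ht
  have htC : ∀ n, C i (a n) (b n) = t n := fun n => rfl
  simp only [htC] at hadm hbad hmin
  have hts : ∀ n, Standard base (t n) := fun n => (hadm n).1
  have has : ∀ n, Standard base (a n) := fun n => (hts n).left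
  set W : Set (Term Ordinal.{u}) := {s | s ∈ admissible base 3 ∧ AccOn (admissible base 3) s}
    with hW
  have hWt : ∀ z ∈ W, ∀ n, lt z (t n) := fun z hz n =>
    (hts n).lt_of_not_le hz.1.1 fun h => hbad n (hz.2.inv (hadm n) h)
  -- A passing term z would satisfy z ≤ y < t_n, contrary to the assumption on the path. So y is
  -- admissible, and minimality makes it accessible.
  have hsub : ∀ n y p, IsOcc (t n) (y :: p) → (∀ w ∈ p, ¬ lt w (t n)) → lt y (t n) → y ∈ W := by
    intro n y p hocc hp hy
    have hst := hocc.standard (hts n)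
    have hya : y ∈ admissible base 3 := by
      refine mem_admissible_of_isOcc (hadm n) hocc fun j _ hpass => ?_
      obtain ⟨q, z, r, rfl, _, hle⟩ := hpass
      refine hp z (by simp) ((hst z (by simp)).lt_of_le_of_lt (hst y (by simp)) (hts n)
        (hle y (by simp)) hy)
    refine ⟨hya, hmin n y hya hy ?_⟩
    rcases hocc.eq_or_sizeOf_lt with h | h
    · rw [h] at hy; exact absurd hy (hts n).irrefl
    · exact h
  set P : Set (Term Ordinal.{u}) := W ∩ ⋃ n, {y | ∃ p, IsOcc (t n) (y :: p)} with hP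
  have hPc : P.Countable :=
    (Set.countable_iUnion fun n => countable_subterms (t n)).mono Set.inter_subset_right
  obtain ⟨g, hg, hgk⟩ := exists_strictMono_constants hPc
    fun z hz => hz.1.2.mono fun w hw => hw.1.1
  have hsubP : ∀ n y p, IsOcc (t n) (y :: p) → (∀ w ∈ p, ¬ lt w (t n)) → lt y (t n) → y ∈ P :=
    fun n y p hocc hp hy => ⟨hsub n y p hocc hp hy, Set.mem_iUnion.2 ⟨n, p, hocc⟩⟩
  have hHull : ∀ n y p, IsOcc (t n) (y :: p) → (∀ w ∈ p, ¬ lt w (t n)) →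
      sizeOf y < sizeOf (t n) → Hull P y := by
    intro n y
    induction y with
    | const k => exact fun p hocc hp _ => .mem (hsubP n _ p hocc hp lt_const_C)
    | C j c d ihc ihd =>
      intro p hocc hp hsize
      by_cases hy : lt (C j c d) (t n)
      · exact .mem (hsubP n _ p hocc hp hy)
      have hys := hocc.standard (hts n) _ List.mem_cons_self
      have hp' : ∀ w ∈ C j c d :: p, ¬ lt w (t n) := by
        intro w hw
        rcases List.mem_cons.1 hw with rfl | hw
        · exact hy
        · exact hp w hw
      refine .C (ihc _ hocc.left hp' ?_) (ihd _ hocc.right hp' ?_)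
        (fun h => hy (hWt _ h.1 n)) fun z hz => ?_
      · refine lt_trans ?_ hsize; simp; omega
      · refine lt_trans ?_ hsize; simp
      · exact hz.1.1.1.lt_of_lt_of_le (hts n) hys (hWt z hz.1 n) (hys.le_of_not_lt (hts n) hy)
  have hroot : ∀ n, IsOcc (t n) (a n :: [t n]) := fun n => IsOcc.left .root
  have hroot' : ∀ n, ∀ w ∈ [t n], ¬ lt w (t n) := by
    intro n w hw
    rw [List.mem_singleton.1 hw]; exact (hts n).irrefl
  have haH : ∀ n, Hull P (a n) := fun n => hHull n _ _ (hroot n) (hroot' n) (by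
    simp only [ht, Term.C.sizeOf_spec]; omega)
  -- The outermost term below t_n on a path belongs to `P`, so a path avoiding `P` has no such term.
  -- This rules out the first alternative of built from below.
  have hpath : ∀ n l, IsOcc (a n) l → (∀ w ∈ l, w ∉ P) → ∀ w ∈ l, ¬ lt w (t n) := by
    intro n l hl
    have key : ∀ y p, IsOcc (a n) (y :: p) → y ∉ P → (∀ w ∈ p, ¬ lt w (t n)) →
        ∀ w ∈ y :: p, ¬ lt w (t n) := by
      intro y p hocc hy hp w hw
      rcases List.mem_cons.1 hw with rfl | hw
      · refine fun h => hy (hsubP n w (p ++ [t n]) ((hroot n).trans hocc) ?_ h)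
        intro w hw
        rcases List.mem_append.1 hw with hw | hw
        · exact hp w hw
        · exact hroot' n w hw
      · exact hp w hw
    induction hl with
    | root => exact fun h => key _ _ .root (h _ List.mem_cons_self) (by simp)
    | left h ih =>
      exact fun hw => key _ _ h.left (hw _ List.mem_cons_self)
        (ih fun w hw' => hw w (List.mem_cons_of_mem _ hw'))
    | right h ih =>
      exact fun hw => key _ _ h.right (hw _ List.mem_cons_self)
        (ih fun w hw' => hw w (List.mem_cons_of_mem _ hw'))
  set x : ℕ → Term Ordinal.{u} := fun n => collapse P g base (a n) with hx
  have hxs : ∀ n, Standard base (x n) := fun n => (haH n).standard_collapse hg (has n)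
  have hxdec : ∀ n, lt (x (n + 1)) (x n) := fun n =>
    ((haH (n + 1)).collapse_lt_iff hg (haH n) (has (n + 1)) (has n)).2 (hdec n)
  have hxbuilt : ∀ n, BuiltByPassing i (x n) := by
    intro n y' p' hocc hlt
    obtain ⟨y, p, ho, hay, rfl, rfl, hw⟩ := (haH n).exists_isOcc_of_lt hg (has n) hocc hlt
    rcases (hts n).builtFromBelow y p ho hay with ⟨z, hz, hzt⟩ | hpass
    · exact absurd hzt (hpath n _ ho (fun w hw' => (hw w hw').2) z hz)
    · exact Hull.passing_collapse hg hw (ho.standard (has n)) hpass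
  have hxadm : ∀ n, x n ∈ admissible base i := by
    intro n
    refine ⟨hxs n, fun j hj c' d' p' hocc hnp => ?_⟩
    rcases (haH n).exists_isOcc hocc with ⟨k, p, h⟩ | ⟨l, hl, h, hw⟩
    · simp at h
    rcases l with _ | ⟨w, l⟩
    · simp at h
    have hwm := hw w List.mem_cons_self
    obtain ⟨j', c, d, rfl, hc, hd, _⟩ := hwm.1.exists_C hwm.2
    have h0 := h
    rw [List.map_cons, collapse_of_notMem hwm.2] at h0
    simp only [List.cons.injEq, Term.C.injEq] at h0
    obtain ⟨⟨rfl, rfl, rfl⟩, rfl⟩ := h0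
    rw [List.map_cons] at h
    have hst := hl.standard (has n)
    have hcs : Standard base c := (hst _ List.mem_cons_self).left
    refine mem_cut_of_le (c := c) ?_ (hc.collapse_le hg hgk hcs) hcs (hc.standard_collapse hg hcs)
    refine (hadm n).2 j j.isLt c d (l ++ [t n]) ((hroot n).trans hl) fun hpass => ?_
    -- Outside a_n the only candidate for the passing term is t_n, whose level i is not below j.
    rcases hpass.of_append hl with hpass | ⟨q, z, r, hz, ⟨k, e, f, rfl, hk⟩, _⟩
    · rw [(List.cons.inj h).1] at hnp
      exact hnp (Hull.passing_collapse hg hw hst hpass)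
    · rcases q with _ | ⟨_, q⟩
      · simp only [List.nil_append, List.cons.injEq, ht, Term.C.injEq] at hz
        obtain ⟨⟨rfl, _⟩, _⟩ := hz
        exact absurd hk (not_lt.2 (Fin.le_def.2 hj.le))
      · simp at hz
  have hcut : a 0 ∈ cut base i := (hadm 0).2 i i.isLt _ _ [] .root (by
    rintro ⟨q, z, r, h, _⟩
    simp at h)
  have hx0 : lt (x 1) (a 0) := (hxs 1).lt_of_lt_of_le (hxs 0) (has 0) (hxdec 0)
    ((haH 0).collapse_le hg hgk (has 0))
  exact not_accOn_of_decreasing (S := {a | a ∈ admissible base i ∧ BuiltByPassing i a})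
    (fun n => ⟨hxadm n, hxbuilt n⟩) hxdec 1
    (mem_cut.1 hcut (x 1) ⟨hxadm 1, hxbuilt 1⟩ hx0)

theorem accOn_admissible_three (base : Ordinal.{u}) :
    ∀ t ∈ admissible base 3, AccOn (admissible base 3) t := by
  intro t ht
  by_contra hta
  obtain ⟨f, hS, hbad, hdec, hmin⟩ := exists_minimal_bad (fun s hs => hs.1) ht hta
  have hC : ∀ n, ∃ i a b, f n = C i a b := by
    intro n
    have := hbad n
    cases hf : f n with
    | const k => rw [hf] at this; exact absurd (accOn_const _ k) this
    | C i a b => exact ⟨i, a, b, rfl⟩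
  choose i a b hf using hC
  -- Only f_n could pass through this occurrence, which would need f_n ≤ b_n. So b_n is admissible,
  -- and it is smaller in both order and size.
  have hb : ∀ n, AccOn (admissible base 3) (b n) := by
    intro n
    have hlt : lt (b n) (f n) := by rw [hf n]; exact lt_C_right _ _ _
    have hocc : IsOcc (f n) [b n, f n] := by rw [hf n]; exact .right .root
    refine hmin n _ (mem_admissible_of_isOcc (hS n) hocc fun j _ hpass => ?_) hlt ?_
    · obtain ⟨q, z, r, hz, _, hle⟩ := hpass
      have hbs := hocc.standard (hS n).1 (b n) List.mem_cons_self
      rcases q with _ | ⟨_, q⟩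
      · simp only [List.nil_append, List.cons.injEq] at hz
        rw [← hz.1] at hle
        exact hbs.not_le_of_lt (hS n).1 hlt (hle _ List.mem_cons_self)
      · simp at hz
    · rw [hf n]; simp
  have hlex : ∀ n, i (n + 1) < i n ∨ (i (n + 1) = i n ∧ lt (a (n + 1)) (a n)) := by
    intro n
    have h := hdec n
    rw [hf n, hf (n + 1)] at h
    rcases lt_C_C.1 h with h | h
    · rw [← hf (n + 1)] at h
      exact absurd ((hb n).inv (hS (n + 1)) h) (hbad (n + 1))
    · exact h.2
  have hanti : Antitone i := antitone_nat_of_succ_le fun n => by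
    rcases hlex n with h | h
    · exact h.le
    · exact h.1.le
  obtain ⟨_, ⟨N, rfl⟩, hN⟩ := wellFounded_lt.has_min (Set.range i) ⟨_, 0, rfl⟩
  have hconst : ∀ n, i (N + n) = i N := fun n =>
    le_antisymm (hanti (Nat.le_add_right N n)) (not_lt.1 (hN _ ⟨_, rfl⟩))
  have hf' : ∀ n, f (N + n) = C (i N) (a (N + n)) (b (N + n)) := fun n => by
    rw [hf (N + n), hconst n]
  refine false_of_minimal_bad (base := base) (i := i N) (a := fun n => a (N + n))
    (b := fun n => b (N + n)) (fun n => ?_) (fun n => ?_) (fun n => ?_) fun n => ?_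
  · rw [← hf' n]; exact hS _
  · rw [← hf' n]; exact hbad _
  · rw [← hf' n]; exact hmin _
  · rcases hlex (N + n) with h | h
    · have h1 := hconst n
      have h2 := hconst (n + 1)
      rw [← add_assoc] at h2
      rw [h1, h2] at h
      exact absurd h (lt_irrefl _)
    · exact h.2

/-- The standard terms over the class of ordinals are well-founded. -/
theorem accOn_standard (base : Ordinal.{u}) {t : Term Ordinal.{u}} (ht : Standard base t) :
    AccOn {t | Standard base t} t := by
  have h3 := accOn_admissible_three base
  have h2 := accOn_of_accOn_succ 2 h3
  have h1 := accOn_of_accOn_succ 1 h2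
  have h0 := accOn_of_accOn_succ 0 h1
  have heq : ∀ s, Standard base s → s ∈ admissible base (0 : Fin 3).val :=
    fun s hs => ⟨hs, fun j hj => absurd hj (Nat.not_lt_zero _)⟩
  exact (h0 t (heq t ht)).mono heq

end Ordinals

end Term

/-! ### Transfer to other sets of constants. -/

/-- Collapsing exactly the constants embeds the system into the one over the ordinals. The base
becomes 0 when it is a second argument, whatever its image elsewhere, so the map of constants need
not respect it. -/
theorem Notation.isWellOrder_of_strictMono {K : Type u} [LinearOrder K] {base : K}
    {g : K → Ordinal.{v}} (hg : StrictMono g) :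
    IsWellOrder (Notation K base) Notation.lt := by
  let P : Set (Term K) := Set.range Term.const
  let G : Term K → Ordinal.{v} := fun t => match t with
    | .const k => g k
    | .C _ _ _ => 0
  have hG : ∀ x ∈ P, ∀ y ∈ P, Term.lt x y → G x < G y := by
    rintro _ ⟨x, rfl⟩ _ ⟨y, rfl⟩ h
    exact hg (Term.lt_const_const.1 h)
  have hHull : ∀ t : Term K, Term.Hull P t := by
    intro t
    induction t with
    | const k => exact .mem ⟨k, rfl⟩
    | C i a b iha ihb =>
      refine .C iha ihb (by rintro ⟨k, h⟩; simp at h) ?_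
      rintro _ ⟨k, rfl⟩
      exact Term.lt_const_C
  refine { wf := ?_, trichotomous := ?_ }
  · let F : Notation K base → {t : Term Ordinal.{v} // Term.Standard 0 t} := fun t =>
      ⟨Term.collapse P G 0 t.1, (hHull t.1).standard_collapse hG t.2⟩
    have hwf : WellFounded fun s t : {t : Term Ordinal.{v} // Term.Standard 0 t} =>
        Term.lt s.1 t.1 := by
      refine ⟨fun t => ?_⟩
      exact Subrelation.accessible (fun {x y} h => ⟨x.2, h⟩)
        (InvImage.accessible Subtype.val (Term.accOn_standard 0 t.2))
    refine Subrelation.wf (fun {s t} h => ?_) (InvImage.wf F hwf)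
    exact ((hHull s.1).collapse_lt_iff hG (hHull t.1) s.2 t.2).2 h
  · rintro ⟨s, hs⟩ ⟨t, ht⟩ h1 h2
    rcases hs.trichotomy ht with h | h | h
    · exact absurd h h1
    · exact Subtype.ext h
    · exact absurd h h2

end Passthrough

theorem mainTheorem2 (α : Ordinal.{u}) :
    IsWellOrder (Passthrough.AboveConstants α) Passthrough.Notation.lt ∧
    IsWellOrder (Passthrough.AboveOrdinal α) Passthrough.Notation.lt :=
  ⟨Passthrough.Notation.isWellOrder_of_strictMono (g := Subtype.val) fun _ _ h => h,
    Passthrough.Notation.isWellOrder_of_strictMono (g := Subtype.val) fun _ _ h => h⟩
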